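/- Let $S=[-\tfrac12,\tfrac12]^2$ be the unit square and $d$ the Euclidean distance. Let $f$ be a probability density on $S$ with $\epsilon_1\le f(x)\le\epsilon_2$ for all $x\in S$, where $0<\epsilon_1\le\epsilon_2<\infty$ are constants, and let $X_1,X_2,\dots$ be i.i.d. random points of $S$ with density $f$. Let $h:S\times S\to[0,\infty)$ be a measurable function such that, for some constants $c_1,c_2>0$, $$c_1\,d(x,y)\le h(x,y)=h(y,x)\le c_2\,d(x,y)\qquad\text{for all }x,y\in S,$$ and let $\alpha>0$. Give the edge joining $X_i$ and $X_j$ the weight $h(X_i,X_j)^\alpha$, and let $$TSP_n=\min_{\sigma}\ \sum_{i=1}^{n}h\big(X_{\sigma(i)},X_{\sigma(i+1)}\big)^{\alpha},\qquad \sigma(n+1):=\sigma(1),$$ the minimum being over all permutations $\sigma$ of $\{1,\dots,n\}$, be the minimum weight of a cycle through all of the nodes $X_1,\dots,X_n$. Then: (i) If $0<\alpha<2(\sqrt2-1)$, then each $TSP_n$ is integrable and $$\frac{TSP_n-\mathbb{E}\,TSP_n}{n^{1-\alpha/2}}\longrightarrow 0\quad\text{almost surely as }n\to\infty.$$ (ii)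 If $h$ is a metric on $S$ and $0<\alpha<1$, then each $TSP_n$ is integrable and $$\frac{TSP_n-\mathbb{E}\,TSP_n}{n^{1-\alpha/2}}\longrightarrow 0\quad\text{almost surely as }n\to\infty.$$ -/

import Mathlib

open MeasureTheory ProbabilityTheory Filter Topology

noncomputable section

/-- The closed unit square `[-1/2, 1/2]²` in the Euclidean plane. As a subtype it carries the
Euclidean distance. -/
def unitSquare : Set (EuclideanSpace ℝ (Fin 2)) :=
  {x | ∀ i, x i ∈ Set.Icc (-(1 / 2) : ℝ) (1 / 2)}

/-- `h` is a metric on `T` (a distance function in the usual sense). -/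
structure IsMetric {T : Type*} (h : T → T → ℝ) : Prop where
  nonneg : ∀ x y, 0 ≤ h x y
  eq_zero_iff : ∀ x y, h x y = 0 ↔ x = y
  symm : ∀ x y, h x y = h y x
  triangle : ∀ x y z, h x z ≤ h x y + h y z

/-- The weight `∑ h^α(e)` of the spanning cycle `(Y_1, …, Y_n, Y_1)` through the nodes
`x 0, …, x (n - 1)`, where the `i`-th visited node is `Y_i = x (σ i)`. The sum runs over the edges
`(Y_1, Y_2), …, (Y_{n-1}, Y_n), (Y_n, Y_1)`: `finRotate n` is the cyclic successor on `Fin n`. -/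
def cycleWeight {T : Type*} (h : T → T → ℝ) (α : ℝ) {n : ℕ} (x : Fin n → T)
    (σ : Equiv.Perm (Fin n)) : ℝ :=
  ∑ i : Fin n, (h (x (σ i)) (x (σ (finRotate n i)))) ^ α

/-- The minimum weight of a spanning cycle through the nodes `x 0, …, x (n - 1)`. -/
def minCycleWeight {T : Type*} (h : T → T → ℝ) (α : ℝ) {n : ℕ} (x : Fin n → T) : ℝ :=
  (Finset.univ : Finset (Equiv.Perm (Fin n))).inf' Finset.univ_nonempty (cycleWeight h α x)

/-- The random variable `TSP_n`: the minimum weight of a spanning cycle through the first `n`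
nodes of the sequence `X`. -/
def TSP {Ω T : Type*} (h : T → T → ℝ) (α : ℝ) (X : ℕ → Ω → T) (n : ℕ) (ω : Ω) : ℝ :=
  minCycleWeight h α (fun i : Fin n => X i ω)

end

open scoped NNReal ENNReal

/-! Edge weights are bounded by a constant `M`, and each node of a cycle meets only two of its
edges, so moving one node changes the minimum weight by at most `2 * M`. McDiarmid's inequality then
makes `TSP_n` sub-Gaussian around its mean with parameter of order `n`. Its fluctuations are thus
almost surely `o(n ^ β)` for every `β > 1 / 2`, by Borel–Cantelli, and `β = 1 - α / 2` qualifies as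
soon as `α < 1`. Both ranges of `α` satisfy this, since `2 * (√2 - 1) < 1`. -/

/-- If `F` is sub-Gaussian in the first variable around its partial mean, and the partial mean is
sub-Gaussian, then `F` is sub-Gaussian around its mean. -/
lemma hasSubgaussianMGF_sub_integral_prod {A B : Type*} [MeasurableSpace A] [MeasurableSpace B]
    {μ : Measure A} {ν : Measure B} [IsProbabilityMeasure μ] [IsProbabilityMeasure ν]
    {F : A × B → ℝ} (hF : Measurable F) {K : ℝ} (hK : ∀ p, |F p| ≤ K) {c c' : ℝ≥0}
    (h₁ : ∀ b, HasSubgaussianMGF (fun a ↦ F (a, b) - ∫ a', F (a', b) ∂μ) c μ)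
    (h₂ : HasSubgaussianMGF (fun b ↦ ∫ a, F (a, b) ∂μ - ∫ b', ∫ a, F (a, b') ∂μ ∂ν) c' ν) :
    HasSubgaussianMGF (fun p ↦ F p - ∫ q, F q ∂(μ.prod ν)) (c + c') (μ.prod ν) := by
  have hint : Integrable F (μ.prod ν) :=
    .of_bound hF.aestronglyMeasurable K (.of_forall fun p ↦ by simpa using hK p)
  have hexp : ∀ t : ℝ,
      Integrable (fun p ↦ Real.exp (t * (F p - ∫ q, F q ∂(μ.prod ν)))) (μ.prod ν) := fun t ↦
    integrable_exp_mul_of_mem_Icc (a := -K - ∫ q, F q ∂(μ.prod ν))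
      (b := K - ∫ q, F q ∂(μ.prod ν)) (by fun_prop) (.of_forall fun p ↦ by
        have := abs_le.1 (hK p)
        constructor <;> linarith)
  refine ⟨hexp, fun t ↦ ?_⟩
  have hmean : ∫ q, F q ∂(μ.prod ν) = ∫ b, ∫ a, F (a, b) ∂μ ∂ν := integral_prod_symm F hint
  rw [mgf, integral_prod_symm _ (hexp t), hmean]
  calc ∫ b, ∫ a, Real.exp (t * (F (a, b) - ∫ b', ∫ a', F (a', b') ∂μ ∂ν)) ∂μ ∂ν
      ≤ ∫ b, Real.exp (c * t ^ 2 / 2) *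
          Real.exp (t * (∫ a, F (a, b) ∂μ - ∫ b', ∫ a', F (a', b') ∂μ ∂ν)) ∂ν := by
        refine integral_mono ?_ ((h₂.integrable_exp_mul t).const_mul _) fun b ↦ ?_
        · have := (hexp t).integral_prod_right
          rwa [hmean] at this
        -- Recentre at the partial mean: the second factor is constant in `a`.
        · have hsplit : ∀ a, Real.exp (t * (F (a, b) - ∫ b', ∫ a', F (a', b') ∂μ ∂ν)) =
              Real.exp (t * (F (a, b) - ∫ a', F (a', b) ∂μ)) *
              Real.exp (t * (∫ a', F (a', b) ∂μ - ∫ b', ∫ a', F (a', b') ∂μ ∂ν)) := fun a ↦ by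
            rw [← Real.exp_add]; ring_nf
          simp only [hsplit, integral_mul_const]
          exact mul_le_mul_of_nonneg_right ((h₁ b).mgf_le t) (Real.exp_nonneg _)
    _ ≤ Real.exp (c * t ^ 2 / 2) * Real.exp (c' * t ^ 2 / 2) := by
        rw [integral_const_mul]
        exact mul_le_mul_of_nonneg_left (h₂.mgf_le t) (Real.exp_nonneg _)
    _ = Real.exp ((c + c' : ℝ≥0) * t ^ 2 / 2) := by
        rw [← Real.exp_add]; push_cast; ring_nf

/-- McDiarmid's inequality: a bounded measurable function of independent variables which moves by
at most `D` when one of its `n` arguments is changed is sub-Gaussian with parameter `n * D ^ 2`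
around its mean. -/
lemma hasSubgaussianMGF_sub_integral_pi {T : Type*} [MeasurableSpace T] {D : ℝ≥0} {K : ℝ} {n : ℕ}
    (μ : Fin n → Measure T) [∀ i, IsProbabilityMeasure (μ i)] {F : (Fin n → T) → ℝ}
    (hF : Measurable F) (hK : ∀ x, |F x| ≤ K)
    (hD : ∀ x i y, |F (Function.update x i y) - F x| ≤ D) :
    HasSubgaussianMGF (fun x ↦ F x - ∫ y, F y ∂(Measure.pi μ)) (n * D ^ 2) (Measure.pi μ) := by
  induction n with
  | zero =>
    have : ∀ x, F x - ∫ y, F y ∂(Measure.pi μ) = 0 := fun x ↦ by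
      have : ∀ y, F y = F x := fun y ↦ by rw [Subsingleton.elim y x]
      simp [this]
    simp [this]
  | succ n ih =>
    set e := MeasurableEquiv.piFinSuccAbove (fun _ : Fin (n + 1) ↦ T) 0
    have he : MeasurePreserving e (Measure.pi μ)
        ((μ 0).prod (Measure.pi fun j : Fin n ↦ μ j.succ)) := by
      exact measurePreserving_piFinSuccAbove μ 0
    set H : T × (Fin n → T) → ℝ := fun p ↦ F (Fin.cons p.1 p.2)
    have hHe : ∀ x, H (e x) = F x := fun x ↦ congrArg F (Fin.cons_self_tail x)
    have hH : Measurable H := by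
      have : H = F ∘ e.symm := by
        ext p
        simpa using hHe (e.symm p)
      exact this ▸ hF.comp e.symm.measurable
    have hHint : ∀ b, Integrable (fun a ↦ H (a, b)) (μ 0) := fun b ↦
      .of_bound (hH.comp measurable_prodMk_right).aestronglyMeasurable K
        (.of_forall fun a ↦ by simpa using hK _)
    have key : HasSubgaussianMGF
        (fun p ↦ H p - ∫ q, H q ∂((μ 0).prod (Measure.pi fun j : Fin n ↦ μ j.succ)))
        (D ^ 2 + n * D ^ 2) ((μ 0).prod (Measure.pi fun j : Fin n ↦ μ j.succ)) := by
      refine hasSubgaussianMGF_sub_integral_prod hH (K := K) (fun p ↦ hK _) (fun b ↦ ?_) ?_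
      · obtain ⟨a₀⟩ : Nonempty T := (μ 0).nonempty_of_neZero
        -- Hoeffding's lemma: an interval of length `2 * D` gives parameter `(2 * D / 2) ^ 2 = D ^
        -- 2`.
        have := hasSubgaussianMGF_of_mem_Icc (X := fun a ↦ H (a, b)) (μ := μ 0)
          (a := H (a₀, b) - D) (b := H (a₀, b) + D) (by fun_prop) (.of_forall fun a ↦ by
            have := abs_le.1 (hD (Fin.cons a₀ b) 0 a)
            rw [Fin.update_cons_zero] at this
            constructor <;> simp only [H] <;> linarith)
        convert this using 2
        ext
        simp [show H (a₀, b) + D - (H (a₀, b) - D) = 2 * D by ring]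
      -- Averaging out the first coordinate preserves the bounded differences.
      · refine ih (fun j ↦ μ j.succ) (F := fun b ↦ ∫ a, H (a, b) ∂(μ 0)) ?_ (fun b ↦ ?_)
          fun b i y ↦ ?_
        · exact hH.stronglyMeasurable.integral_prod_left'.measurable
        · simpa using norm_integral_le_of_norm_le_const (μ := μ 0) (f := fun a ↦ H (a, b)) (C := K)
            (.of_forall fun a ↦ by simpa using hK _)
        · rw [← integral_sub (hHint _) (hHint _)]
          simpa using norm_integral_le_of_norm_le_const (μ := μ 0)
            (f := fun a ↦ H (a, Function.update b i y) - H (a, b)) (C := D)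
            (.of_forall fun a ↦ by
              have := hD (Fin.cons a b) i.succ y
              rw [← Fin.cons_update] at this
              simpa [H] using this)
    rw [← he.map_eq] at key
    have h := key.of_map e.measurable.aemeasurable
    rw [integral_map_equiv] at h
    simp only [hHe, Function.comp_def] at h
    convert h using 1
    push_cast
    ring

/-- McDiarmid's inequality for a function of independent random variables. -/
lemma hasSubgaussianMGF_of_bounded_differences {Ω T : Type*} [MeasurableSpace Ω]
    [MeasurableSpace T] {P : Measure Ω} {D : ℝ≥0} {K : ℝ} {n : ℕ} {Y : Fin n → Ω → T}
    (hY : ∀ i, Measurable (Y i)) (hindep : iIndepFun Y P) {F : (Fin n → T) → ℝ}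
    (hF : Measurable F) (hK : ∀ x, |F x| ≤ K)
    (hD : ∀ x i y, |F (Function.update x i y) - F x| ≤ D) :
    HasSubgaussianMGF (fun ω ↦ F (fun i ↦ Y i ω) - ∫ ω', F (fun i ↦ Y i ω') ∂P) (n * D ^ 2) P := by
  have := hindep.isProbabilityMeasure
  have : ∀ i, IsProbabilityMeasure (P.map (Y i)) := fun i ↦
    Measure.isProbabilityMeasure_map (hY i).aemeasurable
  have hYm : Measurable fun ω i ↦ Y i ω := measurable_pi_lambda _ hY
  have h := hasSubgaussianMGF_sub_integral_pi (fun i ↦ P.map (Y i)) hF hK hD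
  rw [← (iIndepFun_iff_map_fun_eq_pi_map fun i ↦ (hY i).aemeasurable).1 hindep,
    integral_map hYm.aemeasurable hF.aestronglyMeasurable] at h
  exact h.of_map hYm.aemeasurable

/-! ### From sub-Gaussian tails to almost sure convergence -/

lemma summable_exp_neg_mul_rpow {b s : ℝ} (hb : 0 < b) (hs : 0 < s) :
    Summable fun n : ℕ ↦ Real.exp (-b * (n : ℝ) ^ s) := by
  -- The power `-2 / s` of `n ^ s` is the summable `n ^ (-2)`.
  have h := ((isLittleO_exp_neg_mul_rpow_atTop hb (-2 / s)).comp_tendsto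
    ((tendsto_rpow_atTop hs).comp tendsto_natCast_atTop_atTop)).isBigO
  refine summable_of_isBigO_nat (Real.summable_nat_rpow.2 (by norm_num : (-2 : ℝ) < -1))
    (h.congr (fun _ ↦ rfl) fun n ↦ ?_)
  simp only [Function.comp_apply]
  rw [← Real.rpow_mul n.cast_nonneg, mul_div_cancel₀ _ hs.ne']

/-- A sequence whose `n`-th term is sub-Gaussian with parameter `n * c` is almost surely
`o(n ^ β)` for every `β > 1 / 2`. -/
lemma ae_tendsto_div_rpow_of_hasSubgaussianMGF {Ω : Type*} [MeasurableSpace Ω] {P : Measure Ω}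
    [IsFiniteMeasure P] {Z : ℕ → Ω → ℝ} {c : ℝ≥0} (hc : c ≠ 0)
    (hZ : ∀ n : ℕ, HasSubgaussianMGF (Z n) (n * c) P) {β : ℝ} (hβ : 1 / 2 < β) :
    ∀ᵐ ω ∂P, Tendsto (fun n : ℕ ↦ Z n ω / (n : ℝ) ^ β) atTop (𝓝 0) := by
  have hc' : (0 : ℝ) < c := by exact_mod_cast hc.bot_lt
  have tail : ∀ {W : ℕ → Ω → ℝ}, (∀ n : ℕ, HasSubgaussianMGF (W n) (n * c) P) → ∀ ε : ℝ, 0 < ε →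
      ∀ᵐ ω ∂P, ∀ᶠ n : ℕ in atTop, W n ω < ε * (n : ℝ) ^ β := by
    intro W hW ε hε
    have hsum : Summable fun n : ℕ ↦ P.real {ω | ε * (n : ℝ) ^ β ≤ W n ω} := by
      -- The Chernoff exponent is `-(ε * n ^ β) ^ 2 / (2 * n * c)`, and `2 * β - 1 > 0`.
      have hs := summable_exp_neg_mul_rpow (b := ε ^ 2 / (2 * c)) (s := 2 * β - 1)
        (by positivity) (by linarith)
      refine .of_norm_bounded_eventually_nat hs ?_
      filter_upwards [eventually_gt_atTop 0] with n hn
      have hn' : (0 : ℝ) < n := by exact_mod_cast hn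
      rw [Real.norm_of_nonneg measureReal_nonneg]
      refine ((hW n).measure_ge_le (by positivity)).trans_eq ?_
      have hpow : (n : ℝ) ^ (2 * β - 1) = ((n : ℝ) ^ β) ^ 2 / n := by
        rw [Real.rpow_sub_one hn'.ne', mul_comm, Real.rpow_mul hn'.le, Real.rpow_two]
      rw [hpow]
      congr 1
      push_cast
      field_simp
    have hfin : ∑' n : ℕ, P {ω | ε * (n : ℝ) ^ β ≤ W n ω} ≠ ∞ := by
      have := hsum.tsum_ofReal_ne_top
      simpa [ofReal_measureReal] using this
    filter_upwards [ae_eventually_notMem hfin] with ω hω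
    simpa using hω
  have hneg : ∀ n : ℕ, HasSubgaussianMGF ((fun n ↦ -Z n) n) (n * c) P := fun n ↦ (hZ n).neg
  -- Countably many thresholds allow a single null set.
  have hall : ∀ᵐ ω ∂P, ∀ k : ℕ, ∀ᶠ n : ℕ in atTop,
      Z n ω < 1 / ((k : ℝ) + 1) * (n : ℝ) ^ β ∧ -Z n ω < 1 / ((k : ℝ) + 1) * (n : ℝ) ^ β := by
    refine ae_all_iff.2 fun k ↦ ?_
    filter_upwards [tail hZ _ (Nat.one_div_pos_of_nat (n := k)),
      tail hneg _ (Nat.one_div_pos_of_nat (n := k))] with ω h₁ h₂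
    exact h₁.and h₂
  filter_upwards [hall] with ω hω
  rw [Metric.tendsto_nhds]
  intro ε hε
  obtain ⟨k, hk⟩ := exists_nat_one_div_lt hε
  filter_upwards [hω k, eventually_gt_atTop 0] with n hn hn0
  have hpos : (0 : ℝ) < (n : ℝ) ^ β := Real.rpow_pos_of_pos (by exact_mod_cast hn0) _
  rw [Real.dist_eq, sub_zero, abs_div, abs_of_pos hpos, div_lt_iff₀ hpos]
  exact (abs_lt.2 ⟨by linarith [hn.2], hn.1⟩).trans (mul_lt_mul_of_pos_right hk hpos)

/-! ### Bounded differences for the minimum cycle weight -/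

section CycleWeight

variable {T : Type*} {h : T → T → ℝ} {α M : ℝ} {n : ℕ}

lemma abs_cycleWeight_update_sub_le (hM : ∀ x y, h x y ^ α ∈ Set.Icc 0 M) (x : Fin n → T)
    (k : Fin n) (y : T) (σ : Equiv.Perm (Fin n)) :
    |cycleWeight h α (Function.update x k y) σ - cycleWeight h α x σ| ≤ 2 * M := by
  classical
  rw [cycleWeight, cycleWeight, ← Finset.sum_sub_distrib]
  -- Only the edges leaving (`i₁`) and entering (`i₂`) node `k` can change.
  set i₁ := σ.symm k
  set i₂ := (finRotate n).symm (σ.symm k)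
  have hM0 : 0 ≤ M := (hM y y).1.trans (hM y y).2
  calc |∑ i, (h (Function.update x k y (σ i)) (Function.update x k y (σ (finRotate n i))) ^ α -
        h (x (σ i)) (x (σ (finRotate n i))) ^ α)|
      ≤ ∑ i, ((if i = i₁ then M else 0) + if i = i₂ then M else 0) := by
        refine (Finset.abs_sum_le_sum_abs _ _).trans (Finset.sum_le_sum fun i _ ↦ ?_)
        have hA := hM (Function.update x k y (σ i)) (Function.update x k y (σ (finRotate n i)))
        have hB := hM (x (σ i)) (x (σ (finRotate n i)))
        have hAB := abs_sub_le_of_le_of_le hA.1 hA.2 hB.1 hB.2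
        rw [sub_zero] at hAB
        by_cases h₁ : i = i₁
        · rw [if_pos h₁]
          split_ifs <;> linarith
        by_cases h₂ : i = i₂
        · rw [if_pos h₂]
          split_ifs
          linarith
        have e₁ : σ i ≠ k := fun H ↦ h₁ (by simp [i₁, ← H])
        have e₂ : σ (finRotate n i) ≠ k := fun H ↦
          h₂ ((Equiv.eq_symm_apply _).2 ((Equiv.eq_symm_apply _).2 H))
        simp [h₁, h₂, e₁, e₂, -finRotate_apply]
    _ = 2 * M := by
        simp [Finset.sum_add_distrib, two_mul]

lemma minCycleWeight_le (x : Fin n → T) (σ : Equiv.Perm (Fin n)) :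
    minCycleWeight h α x ≤ cycleWeight h α x σ :=
  Finset.inf'_le _ (Finset.mem_univ σ)

/-- A bound uniform in `σ` passes to the minimum over `σ`. -/
lemma abs_minCycleWeight_update_sub_le (hM : ∀ x y, h x y ^ α ∈ Set.Icc 0 M) (x : Fin n → T)
    (k : Fin n) (y : T) :
    |minCycleWeight h α (Function.update x k y) - minCycleWeight h α x| ≤ 2 * M := by
  rw [abs_sub_le_iff, sub_le_iff_le_add', sub_le_iff_le_add', ← sub_le_iff_le_add,
    ← sub_le_iff_le_add]
  constructor <;> refine Finset.le_inf' _ _ fun σ _ ↦ ?_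
  · have := (abs_sub_le_iff.1 (abs_cycleWeight_update_sub_le hM x k y σ)).1
    linarith [minCycleWeight_le (h := h) (α := α) (Function.update x k y) σ]
  · have := (abs_sub_le_iff.1 (abs_cycleWeight_update_sub_le hM x k y σ)).2
    linarith [minCycleWeight_le (h := h) (α := α) x σ]

lemma abs_minCycleWeight_le (hM : ∀ x y, h x y ^ α ∈ Set.Icc 0 M) (x : Fin n → T) :
    |minCycleWeight h α x| ≤ n * M := by
  rw [abs_of_nonneg]
  · refine (minCycleWeight_le x 1).trans ((Finset.sum_le_sum fun i _ ↦ (hM _ _).2).trans_eq ?_)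
    simp
  · exact Finset.le_inf' _ _ fun σ _ ↦ Finset.sum_nonneg fun i _ ↦ (hM _ _).1

lemma measurable_minCycleWeight [MeasurableSpace T] (hh : Measurable (Function.uncurry h)) :
    Measurable fun x : Fin n → T ↦ minCycleWeight h α x := by
  have : (fun x : Fin n → T ↦ minCycleWeight h α x) =
      (Finset.univ : Finset (Equiv.Perm (Fin n))).inf' Finset.univ_nonempty
        (fun σ x ↦ cycleWeight h α x σ) := by
    ext x
    simp [minCycleWeight, Finset.inf'_apply]
  rw [this]
  refine Finset.inf'_induction _ _ (fun _ hf _ hg ↦ hf.inf hg) fun σ _ ↦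
    Finset.measurable_sum _ fun i _ ↦ ?_
  exact (hh.comp (g := Function.uncurry h)
      (f := fun x : Fin n → T ↦ (x (σ i), x (σ (finRotate n i))))
    ((measurable_pi_apply _).prodMk (measurable_pi_apply _))).pow_const α

/-- For bounded edge weights, `TSP` of independent nodes fluctuates by `o(n ^ β)` around its mean,
for every `β > 1 / 2`. -/
lemma integrable_TSP_and_ae_tendsto {Ω : Type*} [MeasurableSpace Ω] {P : Measure Ω}
    [MeasurableSpace T] {X : ℕ → Ω → T} (hX : ∀ i, Measurable (X i)) (hindep : iIndepFun X P)
    (hh : Measurable (Function.uncurry h)) (hM : ∀ x y, h x y ^ α ∈ Set.Icc 0 M)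
    {β : ℝ} (hβ : 1 / 2 < β) :
    (∀ n, Integrable (TSP h α X n) P) ∧
    ∀ᵐ ω ∂P, Tendsto
      (fun n : ℕ ↦ (TSP h α X n ω - ∫ ω', TSP h α X n ω' ∂P) / (n : ℝ) ^ β) atTop (𝓝 0) := by
  have := hindep.isProbabilityMeasure
  have hmeas : ∀ n, Measurable (TSP h α X n) := fun n ↦
    (measurable_minCycleWeight hh).comp (measurable_pi_lambda _ fun i : Fin n ↦ hX i)
  refine ⟨fun n ↦ .of_bound (hmeas n).aestronglyMeasurable (n * M)
    (.of_forall fun ω ↦ abs_minCycleWeight_le hM _), ?_⟩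
  -- The `+ 1` keeps the parameter nonzero even if `M = 0`.
  refine ae_tendsto_div_rpow_of_hasSubgaussianMGF (c := ((2 * M).toNNReal + 1) ^ 2)
    (by positivity) (fun n ↦ ?_) hβ
  refine hasSubgaussianMGF_of_bounded_differences (K := n * M) (fun i : Fin n ↦ hX i)
    (hindep.precomp Fin.val_injective) (measurable_minCycleWeight hh)
    (abs_minCycleWeight_le hM) fun x i y ↦ ?_
  refine (abs_minCycleWeight_update_sub_le hM x i y).trans ?_
  push_cast
  linarith [Real.le_coe_toNNReal (2 * M)]

end CycleWeight

lemma dist_le_two_of_unitSquare (x y : unitSquare) : dist x y ≤ 2 := by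
  rw [Subtype.dist_eq, EuclideanSpace.dist_eq, Real.sqrt_le_left (by norm_num), Fin.sum_univ_two]
  have h : ∀ i, dist ((x : EuclideanSpace ℝ (Fin 2)) i) ((y : EuclideanSpace ℝ (Fin 2)) i) ≤ 1 :=
    fun i ↦ (Real.dist_le_of_mem_Icc (x.2 i) (y.2 i)).trans (by norm_num)
  nlinarith [h 0, h 1, dist_nonneg (x := (x : EuclideanSpace ℝ (Fin 2)) 0)
    (y := (y : EuclideanSpace ℝ (Fin 2)) 0), dist_nonneg (x := (x : EuclideanSpace ℝ (Fin 2)) 1)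
    (y := (y : EuclideanSpace ℝ (Fin 2)) 1)]

theorem theorem4
    {Ω : Type*} [MeasurableSpace Ω] (P : Measure Ω) [IsProbabilityMeasure P]
    -- the density of the nodes on the unit square
    (f : unitSquare → ℝ) (hf : Measurable f)
    (ε₁ ε₂ : ℝ) (hε₁ : 0 < ε₁) (hfε : ∀ x, ε₁ ≤ f x ∧ f x ≤ ε₂)
    -- the i.i.d. nodes
    (X : ℕ → Ω → unitSquare) (hX : ∀ i, Measurable (X i)) (hindep : iIndepFun X P)
    (hlaw : ∀ i, P.map (X i) =
      ((volume : Measure (EuclideanSpace ℝ (Fin 2))).comap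
        (Subtype.val : unitSquare → EuclideanSpace ℝ (Fin 2))).withDensity
          (fun x => ENNReal.ofReal (f x)))
    -- the edge weight function
    (h : unitSquare → unitSquare → ℝ) (hh : Measurable (Function.uncurry h))
    (c₁ c₂ : ℝ) (hc₁ : 0 < c₁) (hc₂ : 0 < c₂)
    (hsymm : ∀ x y, h x y = h y x)
    (hbound : ∀ x y, c₁ * dist x y ≤ h x y ∧ h x y ≤ c₂ * dist x y)
    -- the edge weight exponent
    (α : ℝ) (hα : 0 < α) :
    (α < 2 * (√2 - 1) →
      (∀ n, Integrable (TSP h α X n) P) ∧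
      ∀ᵐ ω ∂P, Tendsto
        (fun n : ℕ => (TSP h α X n ω - ∫ ω', TSP h α X n ω' ∂P) / (n : ℝ) ^ (1 - α / 2))
        atTop (𝓝 0)) ∧
    (IsMetric h → α < 1 →
      (∀ n, Integrable (TSP h α X n) P) ∧
      ∀ᵐ ω ∂P, Tendsto
        (fun n : ℕ => (TSP h α X n ω - ∫ ω', TSP h α X n ω' ∂P) / (n : ℝ) ^ (1 - α / 2))
        atTop (𝓝 0)) := by
  have hM : ∀ x y, h x y ^ α ∈ Set.Icc 0 ((c₂ * 2) ^ α) := fun x y ↦ by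
    have h0 : 0 ≤ h x y := (mul_nonneg hc₁.le dist_nonneg).trans (hbound x y).1
    exact ⟨Real.rpow_nonneg h0 α, Real.rpow_le_rpow h0 ((hbound x y).2.trans
      (mul_le_mul_of_nonneg_left (dist_le_two_of_unitSquare x y) hc₂.le)) hα.le⟩
  have main : α < 1 → _ := fun hα1 ↦
    integrable_TSP_and_ae_tendsto hX hindep hh hM (β := 1 - α / 2) (by linarith)
  refine ⟨fun h1 ↦ main (h1.trans ?_), fun _ h1 ↦ main h1⟩
  have : √2 < 3 / 2 := (Real.sqrt_lt' (by norm_num)).2 (by norm_num)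
  linarith
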